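/- **Proposition (identifiability of the CMCG copula model).** Let $p,d$ be natural numbers. A map $f:\mathbb R^d\to\mathbb R^d$ is *cyclically monotone on* $U\subseteq\mathbb R^d$ if for all $n$ and all $x_1,\dots,x_{n+1}\in U$ with $x_{n+1}=x_1$, $$\sum_{k=1}^n\langle x_{k+1},\,f(x_{k+1})-f(x_k)\rangle\ge 0 .$$ Let $X=(X_1,\dots,X_p)$ be a random vector with $X_j\in\mathbb R^d$, and let $P_j$ be the law of $X_j$. For maps $T=(T_1,\dots,T_p)$, $T_j:\mathbb R^d\to\mathbb R^d$ ($P_j$-a.e. measurable), and a positive semidefinite matrix $\Sigma\in\mathbb R^{pd\times pd}$ with blocks $\Sigma_{jk}\in\mathbb R^{d\times d}$ and $\Sigma_{jj}=I_d$, write $X\sim\mathrm{CMCG}(T,\Sigma)$ if each $T_j$ is cyclically monotone on some set of full $P_j$-measure (for instance on $\mathbb R^d$) and $$(T_1(X_1)^{\mathsf T},\dots,T_p(X_p)^{\mathsf T})^{\mathsf T}\sim N(0,\Sigma).$$ Suppose that $X\sim\mathrm{CMCG}(T,\Sigma)$ and $\tilde X\sim\mathrm{CMCG}(\tilde T,\tilde\Sigma)$,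 possibly defined on different probability spaces, have the same distribution. Then $\Sigma=\tilde\Sigma$, and $T_j=\tilde T_j$ $P_j$-almost everywhere for every $j=1,\dots,p$. Moreover, for every $j$ such that $T_j$ and $\tilde T_j$ are both cyclically monotone on all of $\mathbb R^d$, $T_j=\tilde T_j$ also Lebesgue-almost everywhere. -/

import Mathlib

open MeasureTheory ProbabilityTheory

/-- `f` is cyclically monotone on `U`: for every closed chain `x 0, x 1, …, x n = x 0` of points
of `U`, one has `∑ ⟨x (k+1), f (x (k+1)) - f (x k)⟩ ≥ 0`. -/
def CyclicallyMonotoneOn {E : Type*} [NormedAddCommGroup E] [InnerProductSpace ℝ E]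
    (f : E → E) (U : Set E) : Prop :=
  ∀ (n : ℕ) (x : ℕ → E), (∀ k ≤ n, x k ∈ U) → x n = x 0 →
    0 ≤ ∑ k ∈ Finset.range n, inner ℝ (x (k + 1)) (f (x (k + 1)) - f (x k))

/-- Apply `T j` to the `j`-th node vector and stack the results into one vector of
`ℝ^(p d)`, whose coordinates are indexed by pairs (node, attribute). -/
def stackedTransform {p d : ℕ}
    (T : Fin p → EuclideanSpace ℝ (Fin d) → EuclideanSpace ℝ (Fin d))
    (x : Fin p → EuclideanSpace ℝ (Fin d)) : EuclideanSpace ℝ (Fin p × Fin d) :=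
  WithLp.toLp 2 fun i => T i.1 (x i.1) i.2

/-- `X ∼ CMCG(T, S)`. Here `X` consists of `p` node vectors in `ℝ^d`. Each `T j` is cyclically
monotone where it matters, on a set carrying the law of the `j`-th node vector (the whole space is
allowed), and `(T 1 (X 1), …, T p (X p)) ∼ N(0, S)`, where `S` is a covariance matrix whose
diagonal `d × d` blocks are identity matrices. -/
structure IsCMCG {p d : ℕ} {Ω : Type*} [MeasurableSpace Ω]
    (X : Ω → Fin p → EuclideanSpace ℝ (Fin d)) (P : Measure Ω)
    (T : Fin p → EuclideanSpace ℝ (Fin d) → EuclideanSpace ℝ (Fin d))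
    (S : Matrix (Fin p × Fin d) (Fin p × Fin d) ℝ) : Prop where
  aemeasurable_vector : AEMeasurable X P
  aemeasurable_transform : ∀ j, AEMeasurable (T j) (P.map fun ω => X ω j)
  cyclicallyMonotone : ∀ j, ∃ U : Set (EuclideanSpace ℝ (Fin d)),
    (∀ᵐ x ∂(P.map fun ω => X ω j), x ∈ U) ∧ CyclicallyMonotoneOn (T j) U
  posSemidef : S.PosSemidef
  diagonal_block : ∀ j, S.submatrix (fun s => (j, s)) (fun s => (j, s)) = 1
  gaussian : HasLaw (fun ω => stackedTransform T (X ω)) (multivariateGaussian 0 S) P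

/-! Each `T j` pushes the node law to a standard Gaussian, so uniqueness is one of monotone
transport. Rockafellar's construction is applied to the inverse map: full support makes the image
dense, so there is a finite convex `ψ` with `x` a subgradient of `ψ` at `T x`. For two transports
`S`, `T` with potentials `ψ`, `χ`, the function `ψ - χ` increases from `S x` to `T x`; these have
the same law, so equality holds a.e. and `x` is a subgradient of `ψ` at `T x` too. As `ψ` is
differentiable Gaussian-a.e., `S` and `T` both invert its gradient. No moments are needed.

The stacked Gaussian laws then agree, and with them the covariances. For the Lebesgue statement,
agreement on a set with dense image makes `ψ - χ` constant; both maps are then subgradient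
selections of one finite convex conjugate. -/

section ConvexAnalysis

/-! ### Subgradients and cyclic monotonicity. -/

variable {E : Type*} [NormedAddCommGroup E] [InnerProductSpace ℝ E]

/-- `p` is a subgradient of `f` at `y`. -/
def IsSubgradient (f : E → ℝ) (p y : E) : Prop :=
  ∀ z, f y + inner ℝ p (z - y) ≤ f z

theorem IsSubgradient.eq_gradient [CompleteSpace E] {f : E → ℝ} {p y : E}
    (hp : IsSubgradient f p y) (hf : DifferentiableAt ℝ f y) : p = gradient f y := by
  have hmin : IsLocalMin (fun z => f z - inner ℝ p z) y := by
    refine Filter.Eventually.of_forall fun z => ?_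
    have := hp z
    rw [inner_sub_right] at this
    simp only
    linarith
  have h1 : HasFDerivAt (fun z => f z - inner ℝ p z) (fderiv ℝ f y - innerSL ℝ p) y :=
    hf.hasFDerivAt.sub (innerSL ℝ p).hasFDerivAt
  have h2 := hmin.hasFDerivAt_eq_zero h1
  rw [gradient, LinearIsometryEquiv.eq_symm_apply]
  rw [sub_eq_zero] at h2
  rw [h2]
  rfl

theorem convexOn_univ_of_forall_exists_isSubgradient {f : E → ℝ}
    (h : ∀ y, ∃ p, IsSubgradient f p y) : ConvexOn ℝ Set.univ f := by
  refine ⟨convex_univ, fun x _ y _ a b ha hb hab => ?_⟩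
  obtain ⟨p, hp⟩ := h (a • x + b • y)
  have hx := mul_le_mul_of_nonneg_left (hp x) ha
  have hy := mul_le_mul_of_nonneg_left (hp y) hb
  have hz : a * inner ℝ p (x - (a • x + b • y)) + b * inner ℝ p (y - (a • x + b • y)) = 0 := by
    rw [← real_inner_smul_right, ← real_inner_smul_right, ← inner_add_right]
    have : a • (x - (a • x + b • y)) + b • (y - (a • x + b • y)) = 0 := by
      have hb' : b = 1 - a := by linarith
      subst hb'
      module
    rw [this, inner_zero_right]
  have hs : a * f (a • x + b • y) + b * f (a • x + b • y) = f (a • x + b • y) := by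
    rw [← add_mul, hab, one_mul]
  simp only [smul_eq_mul]
  linarith

/-- Affine subspaces are closed, so `s` spans and has interior; that interior equals the interior of
the closure. -/
theorem Convex.eq_univ_of_dense [FiniteDimensional ℝ E] {s : Set E} (hs : Convex ℝ s)
    (hd : Dense s) : s = Set.univ := by
  have hspan : affineSpan ℝ s = ⊤ := by
    have hcl : IsClosed (affineSpan ℝ s : Set E) := AffineSubspace.closed_of_finiteDimensional _
    have : (affineSpan ℝ s : Set E) = Set.univ :=
      hcl.closure_eq ▸ (hd.mono (subset_affineSpan ℝ s)).closure_eq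
    exact SetLike.coe_injective (by simpa using this)
  have hne := hs.interior_nonempty_iff_affineSpan_eq_top.2 hspan
  have h := hs.interior_closure_eq_interior_of_nonempty_interior hne
  rw [hd.closure_eq, interior_univ] at h
  exact Set.univ_subset_iff.1 (h ▸ interior_subset)

/-- Rademacher's theorem, localised through local Lipschitz continuity. -/
theorem ConvexOn.ae_differentiableAt [FiniteDimensional ℝ E] [MeasurableSpace E] [BorelSpace E]
    {μ : Measure E} [μ.IsAddHaarMeasure] {f : E → ℝ} (hf : ConvexOn ℝ Set.univ f) :
    ∀ᵐ x ∂μ, DifferentiableAt ℝ f x := by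
  rw [ae_iff]
  refine measure_null_of_locally_null _ fun x _ => ?_
  obtain ⟨K, t, ht, hK⟩ := hf.locallyLipschitz x
  refine ⟨_, inter_mem_nhdsWithin _ (interior_mem_nhds.2 ht), ?_⟩
  have h := hK.ae_differentiableWithinAt_of_mem (μ := μ)
  refine measure_mono_null ?_ (ae_iff.1 h)
  rintro y ⟨hy, hyt⟩ hd
  exact hy ((hd (interior_subset hyt)).differentiableAt (mem_interior_iff_mem_nhds.1 hyt))

/-- Subgradients near a limit point are bounded, so a subsequence converges and the inequalities
pass to the limit. -/
theorem isClosed_setOf_exists_common_isSubgradient [FiniteDimensional ℝ E] {f g : E → ℝ}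
    (hf : Continuous f) (hg : Continuous g) :
    IsClosed {y | ∃ p, IsSubgradient f p y ∧ IsSubgradient g p y} := by
  rw [← isSeqClosed_iff_isClosed]
  intro y y₀ hy hlim
  choose p hpf hpg using hy
  obtain ⟨M, hM⟩ := (isCompact_closedBall y₀ 2).exists_bound_of_continuousOn hf.continuousOn
  have hbd : ∀ᶠ n in Filter.atTop, p n ∈ Metric.closedBall (0 : E) (2 * M) := by
    filter_upwards [hlim (Metric.ball_mem_nhds y₀ one_pos)] with n hn
    have hn' : dist (y n) y₀ < 1 := hn
    rw [mem_closedBall_zero_iff]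
    have h1 := hM (y n) (by rw [Metric.mem_closedBall]; linarith)
    rw [Real.norm_eq_abs, abs_le] at h1
    rcases eq_or_ne (p n) 0 with h0 | h0
    · rw [h0, norm_zero]; linarith
    · have hu : ‖(‖p n‖⁻¹ • p n)‖ = 1 := by
        simpa using norm_smul_inv_norm (𝕜 := ℝ) h0
      -- A unit step along `p n` raises `f` by at least `‖p n‖`, while `|f| ≤ M` on the ball of
      -- radius 2.
      have h2 := hM (y n + ‖p n‖⁻¹ • p n) (by
        rw [Metric.mem_closedBall, dist_eq_norm]
        rw [dist_eq_norm] at hn'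
        have := norm_add_le (y n - y₀) (‖p n‖⁻¹ • p n)
        have he : y n + ‖p n‖⁻¹ • p n - y₀ = (y n - y₀) + ‖p n‖⁻¹ • p n := by abel
        rw [he]
        linarith)
      rw [Real.norm_eq_abs, abs_le] at h2
      have h3 := hpf n (y n + ‖p n‖⁻¹ • p n)
      rw [add_sub_cancel_left, real_inner_smul_right, real_inner_self_eq_norm_sq] at h3
      have h4 : ‖p n‖⁻¹ * ‖p n‖ ^ 2 = ‖p n‖ := by
        have := norm_ne_zero_iff.2 h0
        field_simp
      linarith
  obtain ⟨q, -, φ, hφ, hq⟩ := (isCompact_closedBall (0 : E) (2 * M)).tendsto_subseq'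
    hbd.frequently
  have hyφ := hlim.comp hφ.tendsto_atTop
  refine ⟨q, fun z => ?_, fun z => ?_⟩
  · refine le_of_tendsto' ((hf.tendsto _ |>.comp hyφ).add (hq.inner
      (tendsto_const_nhds.sub hyφ))) fun n => hpf (φ n) z
  · refine le_of_tendsto' ((hg.tendsto _ |>.comp hyφ).add (hq.inner
      (tendsto_const_nhds.sub hyφ))) fun n => hpg (φ n) z

theorem sub_le_sub_of_forall_exists_common_isSubgradient {f g : E → ℝ}
    (h : ∀ y, ∃ p, IsSubgradient f p y ∧ IsSubgradient g p y) (a b : E) :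
    f b - g b ≤ f a - g a := by
  choose p hpf hpg using h
  have key : ∀ n : ℕ, (f b - g b) - (f a - g a) ≤ inner ℝ (p b - p a) (b - a) / (n + 1) := by
    intro n
    have hn : (n + 1 : ℝ) ≠ 0 := by positivity
    set z : ℕ → E := fun i => a + ((i : ℝ) / (n + 1)) • (b - a) with hz
    have hstep : ∀ i, z (i + 1) - z i = (1 / (n + 1 : ℝ)) • (b - a) := by
      intro i
      simp only [hz]
      rw [add_sub_add_left_eq_sub, ← sub_smul]
      congr 1
      push_cast
      ring
    -- Using `f` at the right endpoint and `g` at the left makes the bound telescope, leaving a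
    -- factor `1 / (n + 1)`.
    have hi : ∀ i, (f (z (i + 1)) - g (z (i + 1))) - (f (z i) - g (z i)) ≤
        inner ℝ (p (z (i + 1))) ((1 / (n + 1 : ℝ)) • (b - a)) -
          inner ℝ (p (z i)) ((1 / (n + 1 : ℝ)) • (b - a)) := by
      intro i
      have h1 := hpf (z (i + 1)) (z i)
      have h2 := hpg (z i) (z (i + 1))
      rw [← neg_sub (z (i + 1)), hstep, inner_neg_right] at h1
      rw [hstep] at h2
      linarith
    have hsum := Finset.sum_le_sum fun i (_ : i ∈ Finset.range (n + 1)) => hi i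
    rw [Finset.sum_range_sub (fun i => f (z i) - g (z i)),
      Finset.sum_range_sub (fun i => inner ℝ (p (z i)) ((1 / (n + 1 : ℝ)) • (b - a)))] at hsum
    have hz0 : z 0 = a := by simp [hz]
    have hzn : z (n + 1) = b := by
      simp only [hz]
      push_cast
      rw [div_self hn, one_smul]
      abel
    rw [hz0, hzn, ← inner_sub_left, real_inner_smul_right] at hsum
    rw [div_eq_mul_one_div, mul_comm]
    exact hsum
  have hlim : Filter.Tendsto (fun n : ℕ => inner ℝ (p b - p a) (b - a) / ((n : ℝ) + 1))
      Filter.atTop (nhds 0) := by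
    have := (tendsto_one_div_add_atTop_nhds_zero_nat (𝕜 := ℝ)).const_mul
      (inner ℝ (p b - p a) (b - a))
    simpa [div_eq_mul_inv] using this
  have := ge_of_tendsto' hlim key
  linarith

namespace CyclicallyMonotoneOn

theorem mono {f : E → E} {U V : Set E} (h : CyclicallyMonotoneOn f U) (hVU : V ⊆ U) :
    CyclicallyMonotoneOn f V :=
  fun n x hx hn => h n x (fun k hk => hVU (hx k hk)) hn

theorem congr {f g : E → E} {U : Set E} (h : CyclicallyMonotoneOn f U) (hfg : Set.EqOn f g U) :
    CyclicallyMonotoneOn g U := by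
  intro n x hx hn
  refine (h n x hx hn).trans_eq (Finset.sum_congr rfl fun k hk => ?_)
  rw [Finset.mem_range] at hk
  rw [hfg (hx k (by lia)), hfg (hx (k + 1) (by lia))]

/-- Rockafellar's theorem for the inverse of a cyclically monotone map: if the image of `f` is
dense, then the inverse of `f` is a selection of the subdifferential of a finite convex function. -/
theorem exists_convexOn_isSubgradient [FiniteDimensional ℝ E] {f : E → E} {U : Set E}
    (h : CyclicallyMonotoneOn f U) (hd : Dense (f '' U)) :
    ∃ ψ : E → ℝ, ConvexOn ℝ Set.univ ψ ∧ ∀ x ∈ U, IsSubgradient ψ x (f x) := by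
  obtain ⟨x₀, hx₀⟩ : U.Nonempty := hd.nonempty.of_image
  -- Chains have a free start and end at `x₀`; each gives an affine function, and `ψ` is their
  -- supremum.
  let C : Set (ℕ × (ℕ → E)) := {c | (∀ k ≤ c.1, c.2 k ∈ U) ∧ c.2 c.1 = x₀}
  let F : C → E → ℝ := fun c z => inner ℝ (c.1.2 0) (z - f (c.1.2 0)) +
    ∑ k ∈ Finset.range c.1.1, inner ℝ (c.1.2 (k + 1)) (f (c.1.2 k) - f (c.1.2 (k + 1)))
  have hC : Nonempty C := ⟨⟨(0, fun _ => x₀), fun _ _ => hx₀, rfl⟩⟩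
  have hF : ∀ (c : C) (x y : E) (a b : ℝ), a + b = 1 →
      F c (a • x + b • y) = a * F c x + b * F c y := by
    intro c x y a b hab
    have hb : b = 1 - a := by linarith
    subst hb
    simp only [F, inner_sub_right, inner_add_right, real_inner_smul_right]
    ring
  have hbdd : ∀ x ∈ U, BddAbove (Set.range fun c => F c (f x)) := by
    intro x hx
    refine ⟨inner ℝ x (f x - f x₀), ?_⟩
    rintro _ ⟨⟨⟨n, w⟩, hw, hwn⟩, rfl⟩
    simp only at hw hwn
    -- The loop `x, w 0, …, w n = x₀, x`, with `n + 2` steps.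
    let v : ℕ → E := fun k => Nat.casesOn k x fun k => if k ≤ n then w k else x
    have hv0 : v 0 = x := rfl
    have hvs : ∀ k ≤ n, v (k + 1) = w k := fun k hk => if_pos hk
    have hvn : v (n + 1 + 1) = x := if_neg (by lia)
    have hcyc := h (n + 2) v (by
      intro k hk
      rcases k with _ | k
      · exact hx
      · by_cases hkn : k ≤ n
        · rw [hvs k hkn]; exact hw k hkn
        · have : v (k + 1) = x := if_neg hkn
          rw [this]; exact hx) (by rw [hv0]; exact hvn)
    rw [Finset.sum_range_succ, Finset.sum_range_succ', hvn, hvs n le_rfl, hv0, hvs 0 (Nat.zero_le _),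
      hwn] at hcyc
    have hsum : ∑ k ∈ Finset.range n, inner ℝ (v (k + 1 + 1)) (f (v (k + 1 + 1)) - f (v (k + 1))) =
        - ∑ k ∈ Finset.range n, inner ℝ (w (k + 1)) (f (w k) - f (w (k + 1))) := by
      rw [← Finset.sum_neg_distrib]
      refine Finset.sum_congr rfl fun k hk => ?_
      rw [Finset.mem_range] at hk
      rw [hvs k (by lia), hvs (k + 1) (by lia), ← inner_neg_right, neg_sub]
    rw [hsum, ← neg_sub (f x) (f (w 0)), inner_neg_right] at hcyc
    simp only [F]
    linarith
  have hall : ∀ z, BddAbove (Set.range fun c => F c z) := by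
    have hconv : Convex ℝ {z | BddAbove (Set.range fun c => F c z)} := by
      rintro x ⟨A, hA⟩ y ⟨B, hB⟩ a b ha hb hab
      refine ⟨a * A + b * B, ?_⟩
      rintro _ ⟨c, rfl⟩
      simp only
      rw [hF c x y a b hab]
      have h1 := mul_le_mul_of_nonneg_left (hA ⟨c, rfl⟩) ha
      have h2 := mul_le_mul_of_nonneg_left (hB ⟨c, rfl⟩) hb
      simp only at h1 h2
      linarith
    have huniv := hconv.eq_univ_of_dense (hd.mono (by rintro _ ⟨x, hx, rfl⟩; exact hbdd x hx))
    exact Set.eq_univ_iff_forall.1 huniv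
  refine ⟨fun z => ⨆ c, F c z, ⟨convex_univ, fun x _ y _ a b ha hb hab => ?_⟩, fun x hx z => ?_⟩
  · refine ciSup_le fun c => ?_
    rw [hF c x y a b hab]
    have h1 := mul_le_mul_of_nonneg_left (le_ciSup (hall x) c) ha
    have h2 := mul_le_mul_of_nonneg_left (le_ciSup (hall y) c) hb
    simp only [smul_eq_mul]
    linarith
  · simp only
    rw [← le_sub_iff_add_le]
    refine ciSup_le fun c => ?_
    obtain ⟨⟨n, w⟩, hw, hwn⟩ := c
    simp only at hw hwn
    -- Prepending `x` to a chain turns its value at `f x` into an affine minorant of `ψ` with slope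
    -- `x`.
    let v : ℕ → E := fun k => Nat.casesOn k x w
    have hv : (n + 1, v) ∈ C := by
      refine ⟨fun k hk => ?_, hwn⟩
      rcases k with _ | k
      · exact hx
      · exact hw k (by simpa using hk)
    have hle := le_ciSup (hall z) ⟨(n + 1, v), hv⟩
    have hval : F ⟨(n + 1, v), hv⟩ z =
        inner ℝ x (z - f x) + F ⟨(n, w), hw, hwn⟩ (f x) := by
      simp only [F]
      rw [Finset.sum_range_succ']
      have hv0 : v 0 = x := rfl
      have hvs : ∀ k, v (k + 1) = w k := fun _ => rfl
      simp only [hv0, hvs]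
      ring
    rw [hval] at hle
    linarith

/-- Two cyclically monotone maps which agree on a set with dense image agree almost everywhere. -/
theorem ae_eq_of_eqOn_of_dense [FiniteDimensional ℝ E] [MeasurableSpace E] [BorelSpace E]
    {μ : Measure E} [μ.IsAddHaarMeasure] {f g : E → E}
    (hf : CyclicallyMonotoneOn f Set.univ) (hg : CyclicallyMonotoneOn g Set.univ) {A : Set E}
    (hA : Set.EqOn f g A) (hd : Dense (f '' A)) : f =ᵐ[μ] g := by
  obtain ⟨ψ, hψ, hψf⟩ := hf.exists_convexOn_isSubgradient
    (hd.mono (Set.image_mono (Set.subset_univ A)))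
  obtain ⟨χ, hχ, hχg⟩ := hg.exists_convexOn_isSubgradient
    ((hA.image_eq ▸ hd).mono (Set.image_mono (Set.subset_univ A)))
  have hclosed := isClosed_setOf_exists_common_isSubgradient hψ.locallyLipschitz.continuous
    hχ.locallyLipschitz.continuous
  have hall : ∀ y, ∃ p, IsSubgradient ψ p y ∧ IsSubgradient χ p y := by
    have hdense : Dense {y | ∃ p, IsSubgradient ψ p y ∧ IsSubgradient χ p y} := by
      refine hd.mono ?_
      rintro _ ⟨x, hx, rfl⟩
      exact ⟨x, hψf x trivial, hA hx ▸ hχg x trivial⟩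
    have := hclosed.closure_eq ▸ hdense.closure_eq
    exact Set.eq_univ_iff_forall.1 this
  have hle := sub_le_sub_of_forall_exists_common_isSubgradient hall
  have hψg : ∀ x, IsSubgradient ψ x (g x) := by
    intro x z
    have h1 := hχg x trivial z
    have h2 := hle z (g x)
    linarith
  -- The convex conjugate of `ψ`, attained at `f x` and equally at `g x`.
  let φ : E → ℝ := fun x => inner ℝ x (f x) - ψ (f x)
  have hφ : ∀ x, φ x = inner ℝ x (g x) - ψ (g x) := by
    intro x
    have h1 := hψf x trivial (g x)
    have h2 := hψg x (f x)
    rw [inner_sub_right] at h1 h2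
    simp only [φ]
    linarith
  have hφf : ∀ x, IsSubgradient φ (f x) x := by
    intro x z
    have h1 := hψf z trivial (f x)
    rw [inner_sub_right] at h1
    simp only [φ]
    rw [inner_sub_right, real_inner_comm z, real_inner_comm x]
    linarith
  have hφg : ∀ x, IsSubgradient φ (g x) x := by
    intro x z
    have h1 := hψf z trivial (g x)
    rw [inner_sub_right] at h1
    rw [hφ x, inner_sub_right, real_inner_comm z, real_inner_comm x]
    simp only [φ]
    linarith
  filter_upwards [(convexOn_univ_of_forall_exists_isSubgradient
    fun x => ⟨_, hφf x⟩).ae_differentiableAt (μ := μ)] with x hx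
  rw [(hφf x).eq_gradient hx, (hφg x).eq_gradient hx]

end CyclicallyMonotoneOn

end ConvexAnalysis

/-! ### Uniqueness of cyclically monotone transport. -/

section Transport

/-- A measurable function which increases along a second pair of maps with the same law is almost
everywhere constant along the pair. -/
theorem ae_comp_eq_of_map_eq_of_ae_le {α β : Type*} [MeasurableSpace α] [MeasurableSpace β]
    {μ : Measure α} [IsFiniteMeasure μ] {S T : α → β} (hS : Measurable S) (hT : Measurable T)
    (hST : μ.map S = μ.map T) {h : β → ℝ} (hh : Measurable h)
    (hle : ∀ᵐ x ∂μ, h (S x) ≤ h (T x)) : ∀ᵐ x ∂μ, h (S x) = h (T x) := by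
  -- A bounded strictly increasing function makes the integrals finite.
  have ha : Measurable fun y => Real.arctan (h y) := Real.measurable_arctan.comp hh
  have hint : ∀ {R : α → β}, Measurable R → Integrable (fun x => Real.arctan (h (R x))) μ := by
    intro R hR
    refine Integrable.of_bound (ha.comp hR).aestronglyMeasurable (Real.pi / 2) ?_
    refine Filter.Eventually.of_forall fun x => ?_
    rw [Real.norm_eq_abs, abs_le]
    exact ⟨(Real.neg_pi_div_two_lt_arctan _).le, (Real.arctan_lt_pi_div_two _).le⟩
  have hle' : ∀ᵐ x ∂μ, Real.arctan (h (S x)) ≤ Real.arctan (h (T x)) := by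
    filter_upwards [hle] with x hx using Real.arctan_mono hx
  have heq := (integral_eq_iff_of_ae_le (hint hS) (hint hT) hle').1 (by
    rw [← integral_map hS.aemeasurable ha.aestronglyMeasurable, hST,
      integral_map hT.aemeasurable ha.aestronglyMeasurable])
  filter_upwards [heq] with x hx using Real.arctan_injective hx

variable {E : Type*} [MeasurableSpace E]

theorem dense_image_of_ae_mem [TopologicalSpace E] [OpensMeasurableSpace E] {μ ν : Measure E}
    [ν.IsOpenPosMeasure] {T : E → E} (hT : AEMeasurable T μ) (hmap : μ.map T = ν) {U : Set E}
    (hU : ∀ᵐ x ∂μ, x ∈ U) : Dense (T '' U) := by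
  refine dense_iff_inter_open.2 fun O hO hne => ?_
  have hpos : ν O ≠ 0 := (hO.measure_pos ν hne).ne'
  rw [← hmap, Measure.map_apply_of_aemeasurable hT hO.measurableSet] at hpos
  by_contra hempty
  have hsub : T ⁻¹' O ⊆ {x | x ∉ U} := fun x hx hxU => hempty ⟨T x, hx, x, hxU, rfl⟩
  exact hpos (measure_mono_null hsub hU)

variable [NormedAddCommGroup E] [InnerProductSpace ℝ E] [FiniteDimensional ℝ E] [BorelSpace E]

/-- If `x` is a subgradient of `ψ` at `T x`, then `T` inverts the gradient of `ψ` almost everywhere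
with respect to the law of `T`. -/
theorem ae_apply_gradient_eq {μ ν : Measure E} {T : E → E} (hT : Measurable T)
    (hmap : μ.map T = ν) {ψ : E → ℝ} (hψ : ∀ᵐ y ∂ν, DifferentiableAt ℝ ψ y)
    (hsub : ∀ᵐ x ∂μ, IsSubgradient ψ x (T x)) : ∀ᵐ y ∂ν, T (gradient ψ y) = y := by
  have hgrad : Measurable (gradient ψ) :=
    (InnerProductSpace.toDual ℝ E).symm.continuous.measurable.comp (measurable_fderiv ℝ ψ)
  rw [← hmap] at hψ ⊢
  have hset : MeasurableSet {y | T (gradient ψ y) = y} :=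
    measurableSet_eq_fun (hT.comp hgrad) measurable_id
  rw [ae_map_iff hT.aemeasurable hset]
  filter_upwards [ae_of_ae_map hT.aemeasurable hψ, hsub] with x hx hs
  rw [← hs.eq_gradient hx]

theorem CyclicallyMonotoneOn.ae_eq_of_map_eq_of_measurable {μ ν : Measure E} [IsFiniteMeasure μ]
    [ν.IsOpenPosMeasure] (hν : ν ≪ Measure.addHaar) {S T : E → E} (hS : Measurable S)
    (hT : Measurable T) (hmapS : μ.map S = ν) (hmapT : μ.map T = ν) {U : Set E}
    (hU : ∀ᵐ x ∂μ, x ∈ U) (hmS : CyclicallyMonotoneOn S U) (hmT : CyclicallyMonotoneOn T U) :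
    S =ᵐ[μ] T := by
  obtain ⟨ψ, hψ, hψS⟩ := hmS.exists_convexOn_isSubgradient
    (dense_image_of_ae_mem hS.aemeasurable hmapS hU)
  obtain ⟨χ, hχ, hχT⟩ := hmT.exists_convexOn_isSubgradient
    (dense_image_of_ae_mem hT.aemeasurable hmapT hU)
  have hψd : ∀ᵐ y ∂ν, DifferentiableAt ℝ ψ y := hν.ae_le hψ.ae_differentiableAt
  have heq := ae_comp_eq_of_map_eq_of_ae_le (h := fun y => ψ y - χ y) hS hT
    (hmapS.trans hmapT.symm)
    (hψ.locallyLipschitz.continuous.sub hχ.locallyLipschitz.continuous).measurable (by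
      filter_upwards [hU] with x hx
      have h1 := hψS x hx (T x)
      have h2 := hχT x hx (S x)
      rw [← neg_sub (T x), inner_neg_right] at h2
      linarith)
  -- Equality forces `ψ (T x) = ψ (S x) + ⟨x, T x - S x⟩`, so the supporting affine function at `S
  -- x` also touches at `T x`.
  have hψT : ∀ᵐ x ∂μ, IsSubgradient ψ x (T x) := by
    filter_upwards [hU, heq] with x hx he z
    have h1 := hψS x hx z
    have h2 := hχT x hx (S x)
    have h3 : inner ℝ x (z - T x) = inner ℝ x (z - S x) + inner ℝ x (S x - T x) := by
      rw [← inner_add_right, sub_add_sub_cancel]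
    linarith
  have hinv : ∀ᵐ y ∂μ.map T, S (gradient ψ y) = y :=
    hmapT.symm ▸ ae_apply_gradient_eq hS hmapS hψd (hU.mono hψS)
  have hd : ∀ᵐ y ∂μ.map T, DifferentiableAt ℝ ψ y := hmapT.symm ▸ hψd
  filter_upwards [ae_of_ae_map hT.aemeasurable hinv, ae_of_ae_map hT.aemeasurable hd, hψT]
    with x h1 h2 h3
  rwa [← h3.eq_gradient h2] at h1

/-- Uniqueness of the cyclically monotone map transporting `μ` to `ν`, without any moment
assumption. -/
theorem CyclicallyMonotoneOn.ae_eq_of_map_eq {μ ν : Measure E} [IsFiniteMeasure μ]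
    [ν.IsOpenPosMeasure] (hν : ν ≪ Measure.addHaar) {S T : E → E} (hS : AEMeasurable S μ)
    (hT : AEMeasurable T μ) (hmapS : μ.map S = ν) (hmapT : μ.map T = ν) {U V : Set E}
    (hU : ∀ᵐ x ∂μ, x ∈ U) (hV : ∀ᵐ x ∂μ, x ∈ V) (hmS : CyclicallyMonotoneOn S U)
    (hmT : CyclicallyMonotoneOn T V) : S =ᵐ[μ] T := by
  -- On this set of full measure the measurable versions inherit cyclic monotonicity.
  let W : Set E := {x | (x ∈ U ∧ x ∈ V) ∧ S x = hS.mk S x ∧ T x = hT.mk T x}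
  have hW : ∀ᵐ x ∂μ, x ∈ W := (hU.and hV).and (hS.ae_eq_mk.and hT.ae_eq_mk)
  refine hS.ae_eq_mk.trans (.trans ?_ hT.ae_eq_mk.symm)
  refine ae_eq_of_map_eq_of_measurable hν hS.measurable_mk hT.measurable_mk
    ((Measure.map_congr hS.ae_eq_mk).symm.trans hmapS)
    ((Measure.map_congr hT.ae_eq_mk).symm.trans hmapT) hW ?_ ?_
  · exact (hmS.mono fun x hx => hx.1.1).congr fun x hx => hx.2.1
  · exact (hmT.mono fun x hx => hx.1.2).congr fun x hx => hx.2.2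

end Transport

/-! ### Gaussian measures and their marginals. -/

section Gaussian

theorem MeasureTheory.Measure.AbsolutelyContinuous.pi_fin {X : Type*} [MeasurableSpace X]
    {μ ν : Measure X} [SigmaFinite μ] [SigmaFinite ν] (h : μ ≪ ν) (n : ℕ) :
    Measure.pi (fun _ : Fin n => μ) ≪ Measure.pi (fun _ : Fin n => ν) := by
  induction n with
  | zero =>
    rw [Measure.pi_of_empty, Measure.pi_of_empty]
  | succ n ih =>
    have h1 := (measurePreserving_piFinSuccAbove (fun _ : Fin (n + 1) => μ) 0).symm
    have h2 := (measurePreserving_piFinSuccAbove (fun _ : Fin (n + 1) => ν) 0).symm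
    rw [← h1.map_eq, ← h2.map_eq]
    exact (h.prod ih).map h1.measurable

theorem stdGaussian_euclideanSpace_absolutelyContinuous (d : ℕ) :
    stdGaussian (EuclideanSpace ℝ (Fin d)) ≪ volume := by
  rw [← map_pi_eq_stdGaussian, ← (PiLp.volume_preserving_toLp (Fin d)).map_eq]
  exact ((gaussianReal_absolutelyContinuous 0 one_ne_zero).pi_fin d).map
    (PiLp.volume_preserving_toLp (Fin d)).measurable

instance isOpenPosMeasure_stdGaussian_euclideanSpace (d : ℕ) :
    (stdGaussian (EuclideanSpace ℝ (Fin d))).IsOpenPosMeasure := by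
  have : (gaussianReal 0 1).IsOpenPosMeasure :=
    (gaussianReal_absolutelyContinuous' 0 one_ne_zero).isOpenPosMeasure
  rw [← map_pi_eq_stdGaussian]
  exact (PiLp.continuous_toLp 2 _).isOpenPosMeasure_map (WithLp.toLp_surjective 2)

theorem multivariateGaussian_zero_injOn {ι : Type*} [Fintype ι] [DecidableEq ι] :
    Set.InjOn (fun S : Matrix ι ι ℝ => multivariateGaussian 0 S) {S | S.PosSemidef} := by
  intro S hS S' hS' h
  ext i j
  rw [← covariance_eval_multivariateGaussian (μ := 0) hS,
    ← covariance_eval_multivariateGaussian (μ := 0) hS']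
  exact congrArg (fun m => covariance (fun x : EuclideanSpace ℝ ι => x i) (fun x => x j) m) h

/-- The projection of a stacked vector to the `j`-th node vector. -/
def nodeProj {p d : ℕ} (j : Fin p) (x : EuclideanSpace ℝ (Fin p × Fin d)) :
    EuclideanSpace ℝ (Fin d) :=
  WithLp.toLp 2 fun s => x (j, s)

theorem measurable_nodeProj {p d : ℕ} (j : Fin p) : Measurable (nodeProj (d := d) j) := by
  unfold nodeProj
  fun_prop

theorem map_nodeProj_multivariateGaussian {p d : ℕ} (j : Fin p)
    {S : Matrix (Fin p × Fin d) (Fin p × Fin d) ℝ} (hS : S.PosSemidef)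
    (hj : S.submatrix (fun s => (j, s)) (fun s => (j, s)) = 1) :
    (multivariateGaussian 0 S).map (nodeProj j) = stdGaussian (EuclideanSpace ℝ (Fin d)) := by
  have : IsProbabilityMeasure ((multivariateGaussian 0 S).map (nodeProj (d := d) j)) :=
    Measure.isProbabilityMeasure_map (measurable_nodeProj j).aemeasurable
  refine Measure.ext_of_charFun (funext fun t => ?_)
  -- Padding `t` by zeros: the quadratic form of `S` at `u` sees only the `j`-th diagonal block.
  let u : EuclideanSpace ℝ (Fin p × Fin d) :=
    WithLp.toLp 2 fun i => if i.1 = j then t i.2 else 0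
  have hinner : ∀ x, inner ℝ (nodeProj j x) t = inner ℝ x u := by
    intro x
    simp only [nodeProj, u, PiLp.inner_apply, Fintype.sum_prod_type]
    rw [Finset.sum_eq_single j]
    · simp
    · intro k _ hk
      simp [hk]
    · simp
  have hquad : dotProduct u.ofLp (S.mulVec u.ofLp) = ‖t‖ ^ 2 := by
    have hsum : ∀ g : Fin p × Fin d → ℝ, ∑ i, u.ofLp i * g i = ∑ s, t s * g (j, s) := by
      intro g
      simp only [u, Fintype.sum_prod_type]
      rw [Finset.sum_eq_single j]
      · simp
      · intro k _ hk
        simp [hk]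
      · simp
    have hmul : ∀ s, S.mulVec u.ofLp (j, s) = t s := by
      intro s
      rw [Matrix.mulVec, dotProduct_comm, dotProduct, hsum]
      have hrow : ∀ r, S (j, s) (j, r) = (1 : Matrix (Fin d) (Fin d) ℝ) s r := by
        intro r
        rw [← hj]
        rfl
      simp [hrow, Matrix.one_apply]
    rw [dotProduct, hsum, EuclideanSpace.real_norm_sq_eq]
    simp [hmul, sq]
  have hchar : charFun ((multivariateGaussian 0 S).map (nodeProj j)) t =
      charFun (multivariateGaussian 0 S) u := by
    rw [charFun_apply, charFun_apply, integral_map (measurable_nodeProj j).aemeasurable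
      (Measurable.aestronglyMeasurable (by fun_prop))]
    simp_rw [hinner]
  rw [hchar, charFun_multivariateGaussian hS, hquad, charFun_stdGaussian]
  simp [neg_div]

end Gaussian

/-! ### The CMCG model and identifiability. -/

section Model

variable {p d : ℕ} {Ω : Type*} [MeasurableSpace Ω]
  {X : Ω → Fin p → EuclideanSpace ℝ (Fin d)} {P : Measure Ω}
  {T : Fin p → EuclideanSpace ℝ (Fin d) → EuclideanSpace ℝ (Fin d)}
  {S : Matrix (Fin p × Fin d) (Fin p × Fin d) ℝ}

theorem IsCMCG.aemeasurable_node (hX : IsCMCG X P T S) (j : Fin p) :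
    AEMeasurable (fun ω => X ω j) P :=
  (measurable_pi_apply j).comp_aemeasurable hX.aemeasurable_vector

theorem IsCMCG.map_transform (hX : IsCMCG X P T S) (j : Fin p) :
    (P.map fun ω => X ω j).map (T j) = stdGaussian (EuclideanSpace ℝ (Fin d)) := by
  rw [← map_nodeProj_multivariateGaussian j hX.posSemidef (hX.diagonal_block j),
    ← hX.gaussian.map_eq, AEMeasurable.map_map_of_aemeasurable
      (measurable_nodeProj j).aemeasurable hX.gaussian.aemeasurable,
    AEMeasurable.map_map_of_aemeasurable (hX.aemeasurable_transform j) (hX.aemeasurable_node j)]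
  rfl

theorem aemeasurable_stackedTransform (hX : AEMeasurable X P)
    (hT : ∀ j, AEMeasurable (T j) (P.map fun ω => X ω j)) :
    AEMeasurable (stackedTransform T) (P.map X) := by
  refine (PiLp.continuous_toLp 2 _).measurable.comp_aemeasurable (aemeasurable_pi_lambda _ ?_)
  rintro ⟨j, s⟩
  have hmap : (P.map X).map (fun x => x j) = P.map fun ω => X ω j :=
    AEMeasurable.map_map_of_aemeasurable (measurable_pi_apply j).aemeasurable hX
  have h : AEMeasurable (fun x : Fin p → EuclideanSpace ℝ (Fin d) => T j (x j)) (P.map X) :=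
    AEMeasurable.comp_aemeasurable (hmap.symm ▸ hT j) (measurable_pi_apply j).aemeasurable
  have he : Measurable fun v : EuclideanSpace ℝ (Fin d) => v s := by fun_prop
  exact he.comp_aemeasurable h

end Model

theorem mainTheorem6 {p d : ℕ}
    {Ω : Type*} [MeasurableSpace Ω] (P : Measure Ω) [IsProbabilityMeasure P]
    {Ω' : Type*} [MeasurableSpace Ω'] (P' : Measure Ω') [IsProbabilityMeasure P']
    (X : Ω → Fin p → EuclideanSpace ℝ (Fin d))
    (X' : Ω' → Fin p → EuclideanSpace ℝ (Fin d))
    (T T' : Fin p → EuclideanSpace ℝ (Fin d) → EuclideanSpace ℝ (Fin d))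
    (S S' : Matrix (Fin p × Fin d) (Fin p × Fin d) ℝ)
    (hX : IsCMCG X P T S) (hX' : IsCMCG X' P' T' S')
    (hlaw : IdentDistrib X X' P P') :
    S = S' ∧
      (∀ j, T j =ᵐ[P.map fun ω => X ω j] T' j) ∧
      (∀ j, CyclicallyMonotoneOn (T j) Set.univ → CyclicallyMonotoneOn (T' j) Set.univ →
        T j =ᵐ[volume] T' j) := by
  have hnode : ∀ j, P.map (fun ω => X ω j) = P'.map fun ω => X' ω j := fun j =>
    (hlaw.comp (measurable_pi_apply j)).map_eq
  have hac : stdGaussian (EuclideanSpace ℝ (Fin d)) ≪ Measure.addHaar :=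
    (stdGaussian_euclideanSpace_absolutelyContinuous d).trans
      (Measure.absolutelyContinuous_isAddHaarMeasure _ _)
  have hae : ∀ j, T j =ᵐ[P.map fun ω => X ω j] T' j := by
    intro j
    have : IsProbabilityMeasure (P.map fun ω => X ω j) :=
      Measure.isProbabilityMeasure_map (hX.aemeasurable_node j)
    obtain ⟨U, hU, hmU⟩ := hX.cyclicallyMonotone j
    obtain ⟨V, hV, hmV⟩ := hX'.cyclicallyMonotone j
    have hT' := hX'.aemeasurable_transform j
    have hmap' := hX'.map_transform j
    rw [← hnode j] at hV hT' hmap'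
    exact CyclicallyMonotoneOn.ae_eq_of_map_eq hac (hX.aemeasurable_transform j) hT'
      (hX.map_transform j) hmap' hU hV hmU hmV
  refine ⟨?_, hae, fun j hm hm' => ?_⟩
  · refine multivariateGaussian_zero_injOn hX.posSemidef hX'.posSemidef ?_
    have hstack : (fun ω => stackedTransform T (X ω)) =ᵐ[P] fun ω => stackedTransform T' (X ω) := by
      have := ae_all_iff.2 fun j => ae_of_ae_map (hX.aemeasurable_node j) (hae j)
      filter_upwards [this] with ω hω
      simp only [stackedTransform, hω]
    have hm' := aemeasurable_stackedTransform hX'.aemeasurable_vector hX'.aemeasurable_transform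
    have hm : AEMeasurable (stackedTransform T') (P.map X) := hlaw.map_eq ▸ hm'
    change multivariateGaussian 0 S = multivariateGaussian 0 S'
    rw [← hX.gaussian.map_eq, ← hX'.gaussian.map_eq, Measure.map_congr hstack]
    calc P.map (fun ω => stackedTransform T' (X ω))
        = (P.map X).map (stackedTransform T') :=
          (AEMeasurable.map_map_of_aemeasurable hm hX.aemeasurable_vector).symm
      _ = (P'.map X').map (stackedTransform T') := by rw [hlaw.map_eq]
      _ = P'.map (fun ω => stackedTransform T' (X' ω)) :=
          AEMeasurable.map_map_of_aemeasurable hm' hX'.aemeasurable_vector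
  -- The node law may be singular to Lebesgue measure; only the density of the image of the
  -- agreement set is used.
  · exact hm.ae_eq_of_eqOn_of_dense hm' (A := {x | T j x = T' j x}) (fun x hx => hx)
      (dense_image_of_ae_mem (hX.aemeasurable_transform j) (hX.map_transform j) (hae j))
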